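/- Let $d\ge 0$, let $\mathcal Z$ be a measurable space with a probability distribution $\mathcal D$, and let $\mathcal S=(z_i)_{i\ge 1}$ be i.i.d. with law $\mathcal D$. Let $\ell:\mathbb R^d\times\mathcal Z\to[0,\infty)$ be a loss, measurable in $z$, such that for every $z\in\mathcal Z$ the map $\ell(\cdot,z)$ is $\mathcal C^2$ with $G$-Lipschitz gradient (Euclidean norm), where $G\ge 0$. For $m\ge 1$ and $h\in\mathbb R^d$ put $$\hat R_{\mathcal S_m}(h)=\frac1m\sum_{i=1}^m\ell(h,z_i),\qquad \text{G-}\hat R_{\mathcal S_m}(h)=\frac1m\sum_{i=1}^m\|\nabla_h\ell(h,z_i)\|^2,$$ and for a distribution $Q$ on $\mathbb R^d$ put $R_{\mathcal D}(Q)=\mathbb E_{h\sim Q}\mathbb E_{z\sim\mathcal D}[\ell(h,z)]$. Say that $Q$ is $\mathrm{QSB}(f,C)$, for $f:\mathbb R^d\times\mathcal Z\to[0,\infty)$, if $\mathbb E_{z\sim\mathcal D}\big[(\mathbb E_{h\sim Q}f(h,z))^2\big]\le C\,\mathbb E_{z\sim\mathcal D}\mathbb E_{h\sim Q}[f(h,z)]$,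 both sides being finite. Let $H^1(Q)$ be the set of differentiable $f:\mathbb R^d\to\mathbb R$ with $f,\|\nabla f\|\in L^2(Q)$. For $\kappa>0$ and $Q=\mathcal N(\mu_Q,\sigma^2\mathrm{Id})$ define $$\mathrm{Sharp}_{\kappa}(Q)=\mathbb E_{\nu\sim\mathcal N(0,\sigma^2\mathrm{Id})}\Big[\big(2\hat R_{\mathcal S_m}+\kappa\,\text{G-}\hat R_{\mathcal S_m}\big)(\mu_Q+\nu)-\big(2\hat R_{\mathcal S_m}+\kappa\,\text{G-}\hat R_{\mathcal S_m}\big)(\mu_Q)\Big].$$ For any $C_1,C_2>0$, $\sigma>0$ and $G\ge 0$ there is a constant $K>0$, depending only on $C_1,C_2,\sigma,G$, such that for all $d,\mathcal Z,\mathcal D,\ell$ as above, any data-free prior $P=\mathcal N(\mu_P,\sigma^2\mathrm{Id})$ and any $\delta\in(0,1]$, with probability at least $1-\delta$ over $\mathcal S$, the following holds simultaneously for all $m\ge 1$ and all $Q=\mathcal N(\mu_Q,\sigma^2\mathrm{Id})$ that are $\mathrm{QSB}(\ell,C_1)$ and $\mathrm{QSB}(\|\nabla_h\ell\|^2,C_2)$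 and satisfy $\ell(\cdot,z),\ \|\nabla_h\ell(\cdot,z)\|^2\in H^1(Q)$ for all $z\in\mathcal Z$: $$R_{\mathcal D}(Q)\le 2\hat R_{\mathcal S_m}(\mu_Q)+\frac{\sigma^2}{C_1}\,\text{G-}\hat R_{\mathcal S_m}(\mu_Q)+\mathrm{Sharp}_{\sigma^2/C_1}(Q)+K\,\frac{\mathrm{KL}(Q,P)+\log(2/\delta)}{m}.$$ -/

import Mathlib

open MeasureTheory ProbabilityTheory

namespace PacBayes

noncomputable section

/-- The predictor space `ℝ^d` with its Euclidean norm. -/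
abbrev Pred (d : ℕ) : Type := EuclideanSpace ℝ (Fin d)

/-- The Gaussian measure on `ℝ^d` with mean `μ` and covariance matrix `v • Id`. -/
def isoGaussian {d : ℕ} (μ : Pred d) (v : ℝ) : Measure (Pred d) :=
  multivariateGaussian μ (v • (1 : Matrix (Fin d) (Fin d) ℝ))

/-- The Sobolev space `H¹(Q)`: differentiable functions `f : ℝ^d → ℝ` such that
`f` and `‖∇ f‖` belong to `L²(Q)`. -/
structure MemH1 {d : ℕ} (f : Pred d → ℝ) (Q : Measure (Pred d)) : Prop where
  differentiable : Differentiable ℝ f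
  memLp : MemLp f 2 Q
  memLp_gradient : MemLp (fun h => ‖gradient f h‖) 2 Q

/-- The squared norm of the gradient of the loss in the predictor variable,
`(h, z) ↦ ‖∇_h ℓ(h, z)‖²`. -/
def gradSq {d : ℕ} {Z : Type*} (ℓ : Pred d → Z → ℝ) (h : Pred d) (z : Z) : ℝ :=
  ‖gradient (fun h' => ℓ h' z) h‖ ^ 2

/-- The population risk `R_D(h) = E_{z ∼ D} [ℓ(h, z)]` of a predictor. -/
def popRisk {d : ℕ} {Z : Type*} [MeasurableSpace Z] (D : Measure Z)
    (ℓ : Pred d → Z → ℝ) (h : Pred d) : ℝ :=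
  ∫ z, ℓ h z ∂D

/-- The population risk `R_D(Q) = E_{h ∼ Q} [R_D(h)]` of a distribution over predictors. -/
def expPopRisk {d : ℕ} {Z : Type*} [MeasurableSpace Z] (D : Measure Z)
    (ℓ : Pred d → Z → ℝ) (Q : Measure (Pred d)) : ℝ :=
  ∫ h, popRisk D ℓ h ∂Q

/-- The empirical risk `(1/m) ∑_i ℓ(h, z_i)` of a predictor on the first `m` points of `S`. -/
def empRisk {d : ℕ} {Z : Type*} (ℓ : Pred d → Z → ℝ) (S : ℕ → Z) (m : ℕ) (h : Pred d) : ℝ :=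
  (1 / (m : ℝ)) * ∑ i ∈ Finset.range m, ℓ h (S i)

/-- The empirical gradient risk `(1/m) ∑_i ‖∇_h ℓ(h, z_i)‖²`. -/
def gradEmpRisk {d : ℕ} {Z : Type*} (ℓ : Pred d → Z → ℝ) (S : ℕ → Z) (m : ℕ) (h : Pred d) : ℝ :=
  empRisk (gradSq ℓ) S m h

/-- The error `Err(ℓ, Q, z) = E_{h ∼ Q} [ℓ(h, z)]` of `Q` at the datum `z`. -/
def err {d : ℕ} {Z : Type*} (ℓ : Pred d → Z → ℝ) (Q : Measure (Pred d)) (z : Z) : ℝ :=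
  ∫ h, ℓ h z ∂Q

/-- `Q` is quadratically self-bounded with respect to `ℓ` and the constant `C`:
`E_{z ∼ D} [Err(ℓ, Q, z)²] ≤ C * R_D(Q)`, both expectations being finite. -/
structure QSB {d : ℕ} {Z : Type*} [MeasurableSpace Z] (D : Measure Z)
    (ℓ : Pred d → Z → ℝ) (Q : Measure (Pred d)) (C : ℝ) : Prop where
  integrable : Integrable (Function.uncurry ℓ) (Q.prod D)
  integrable_err_sq : Integrable (fun z => err ℓ Q z ^ 2) D
  bound : ∫ z, err ℓ Q z ^ 2 ∂D ≤ C * expPopRisk D ℓ Q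

/-- The sharpness, with parameter `κ`, of the Gaussian distribution with mean `μ` and
covariance `v • Id`: with `F = 2 * empRisk + κ * gradEmpRisk`, it is
`E_{ν ∼ N(0, v Id)} [F (μ + ν) - F μ]`. -/
def sharp {d : ℕ} {Z : Type*} (κ : ℝ) (ℓ : Pred d → Z → ℝ) (S : ℕ → Z) (m : ℕ)
    (μ : Pred d) (v : ℝ) : ℝ :=
  ∫ ν, ((2 * empRisk ℓ S m (μ + ν) + κ * gradEmpRisk ℓ S m (μ + ν))
    - (2 * empRisk ℓ S m μ + κ * gradEmpRisk ℓ S m μ)) ∂(isoGaussian (0 : Pred d) v)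

end

end PacBayes

/-! A time-uniform PAC-Bayes bound is applied to `ℓ` and to `gradSq ℓ`, and the two results are
combined. For `f ≥ 0`, normalised products of `exp (-t f)` along the sample, averaged over the
prior, form a nonnegative supermartingale started at 1. Ville's inequality controls all `m` at once
and Donsker–Varadhan passes from the prior to every `Q` (`exists_event_expPopRisk_le`). The price is
`(KL + log a) / (t m)` plus `t / 2` times the second moment of `f` under `Q ⊗ D`.

The Gaussian Poincaré inequality in `h` splits that second moment into `E_z (E_h f)²`, which QSB
controls, and `2σ² E ‖∇f‖²` (`integral_sq_le_of_QSB`). For `ℓ` the gradient term is the risk of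
`gradSq ℓ`. For `gradSq ℓ` it is at most `8σ²G²` times its own risk, because the Hessian of `ℓ` is
bounded by `G`. The second bound therefore closes on itself and feeds the first; suitable values of
`t` let the risks be absorbed on the left (`risk_le_of_self_bounds`). Finally
`add_sharp_eq_integral` turns posterior averages of empirical risks into values at the mean plus
sharpness. -/

open scoped ENNReal RealInnerProductSpace

namespace PacBayes

/-! ### Translates of the standard Gaussian. -/

section GaussianShift

variable {ι : Type*} [Fintype ι]

/-- Complex coefficients let one formula serve as Laplace transform, characteristic function and
their mixture. -/
lemma integral_cexp_sum_stdGaussian (c : ι → ℂ) :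
    ∫ x, Complex.exp (∑ i, c i * (x i : ℂ)) ∂(stdGaussian (EuclideanSpace ℝ ι))
      = Complex.exp (∑ i, c i ^ 2 / 2) := by
  rw [← map_pi_eq_stdGaussian, integral_map (by fun_prop) (by fun_prop)]
  simp_rw [Complex.exp_sum]
  rw [integral_fintype_prod_eq_prod (f := fun i (x : ℝ) ↦ Complex.exp (c i * x))]
  refine Finset.prod_congr rfl fun i _ ↦ ?_
  have h := complexMGF_id_gaussianReal (μ := 0) (v := 1) (c i)
  simpa [complexMGF] using h

lemma integrable_exp_inner_stdGaussian (a : EuclideanSpace ℝ ι) :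
    Integrable (fun x ↦ Real.exp ⟪a, x⟫) (stdGaussian (EuclideanSpace ℝ ι)) := by
  have h := integral_cexp_sum_stdGaussian (fun i ↦ (a i : ℂ))
  have h2 : ∀ x : EuclideanSpace ℝ ι, Complex.exp (∑ i, (a i : ℂ) * (x i : ℂ))
      = (Real.exp ⟪a, x⟫ : ℝ) := by
    intro x
    rw [PiLp.inner_apply, Complex.ofReal_exp]
    push_cast
    simp [mul_comm]
  simp_rw [h2] at h
  -- A non-integrable function has integral `0` by convention, but the integral is a value of `exp`.
  by_contra hn
  rw [integral_complex_ofReal, integral_undef hn] at h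
  exact Complex.exp_ne_zero _ h.symm

/-- The Cameron–Martin formula for the standard Gaussian measure. -/
lemma map_const_add_stdGaussian (a : EuclideanSpace ℝ ι) :
    (stdGaussian (EuclideanSpace ℝ ι)).map (fun x ↦ a + x)
      = (stdGaussian (EuclideanSpace ℝ ι)).tilted (fun x ↦ ⟪a, x⟫) := by
  have hint := integrable_exp_inner_stdGaussian a
  have := isProbabilityMeasure_tilted hint
  have := Measure.isProbabilityMeasure_map (μ := stdGaussian (EuclideanSpace ℝ ι))
    (f := fun x ↦ a + x) (by fun_prop)
  have hnorm : ((∫ x, Real.exp ⟪a, x⟫ ∂(stdGaussian (EuclideanSpace ℝ ι)) : ℝ) : ℂ)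
      = Complex.exp (∑ i, (a i : ℂ) ^ 2 / 2) := by
    rw [← integral_cexp_sum_stdGaussian, ← integral_complex_ofReal]
    congr with x
    rw [PiLp.inner_apply, Complex.ofReal_exp]
    push_cast
    simp [mul_comm]
  -- In characteristic functions the normalising factor `exp (-‖a‖² / 2)` cancels the square of `a`
  -- in `(a + i t)²`; the cross term is the phase of the shift.
  refine Measure.ext_of_charFun ?_
  ext t
  rw [charFun_apply, charFun_apply, integral_tilted, integral_map (by fun_prop) (by fun_prop)]
  have h1 : ∀ x : EuclideanSpace ℝ ι, Complex.exp ((⟪a + x, t⟫ : ℝ) * Complex.I)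
      = Complex.exp (∑ i, (a i : ℂ) * t i * Complex.I)
        * Complex.exp (∑ i, (t i * Complex.I) * (x i : ℂ)) := by
    intro x
    rw [← Complex.exp_add, ← Finset.sum_add_distrib, PiLp.inner_apply]
    push_cast
    rw [Finset.sum_mul]
    congr 1
    refine Finset.sum_congr rfl fun i _ ↦ ?_
    simp
    ring
  have h2 : ∀ x : EuclideanSpace ℝ ι,
      (Real.exp ⟪a, x⟫ / ∫ x, Real.exp ⟪a, x⟫ ∂(stdGaussian (EuclideanSpace ℝ ι)))
        • Complex.exp ((⟪x, t⟫ : ℝ) * Complex.I)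
      = Complex.exp (-∑ i, (a i : ℂ) ^ 2 / 2)
        * Complex.exp (∑ i, (a i + t i * Complex.I) * (x i : ℂ)) := by
    intro x
    rw [Complex.real_smul, Complex.ofReal_div, hnorm, Complex.ofReal_exp, ← Complex.exp_sub,
      ← Complex.exp_add, ← Complex.exp_add, PiLp.inner_apply, PiLp.inner_apply]
    push_cast
    congr 1
    simp only [Finset.sum_mul, add_mul, Finset.sum_add_distrib]
    rw [sub_add_eq_add_sub, sub_eq_neg_add]
    congr 2
    · exact Finset.sum_congr rfl fun i _ ↦ by simp; ring
    · exact Finset.sum_congr rfl fun i _ ↦ by simp; ring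
  simp_rw [h1, h2]
  rw [integral_const_mul, integral_const_mul, integral_cexp_sum_stdGaussian,
    integral_cexp_sum_stdGaussian, ← Complex.exp_add, ← Complex.exp_add,
    ← Finset.sum_neg_distrib, ← Finset.sum_add_distrib, ← Finset.sum_add_distrib]
  congr 1
  exact Finset.sum_congr rfl fun i _ ↦ by ring

/-- The log-likelihood ratio of a tilt is affine in `x`, and a Gaussian has a first moment. -/
lemma integrable_llr_map_const_add_stdGaussian (a : EuclideanSpace ℝ ι) :
    Integrable (llr ((stdGaussian (EuclideanSpace ℝ ι)).map (fun x ↦ a + x))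
      (stdGaussian (EuclideanSpace ℝ ι)))
      ((stdGaussian (EuclideanSpace ℝ ι)).map (fun x ↦ a + x)) := by
  have hint := integrable_exp_inner_stdGaussian a
  have hid : Integrable (fun x ↦ ⟪a, x⟫) ((stdGaussian (EuclideanSpace ℝ ι)).map
      (fun x ↦ a + x)) :=
    (innerSL ℝ a).integrable_comp (IsGaussian.integrable_id)
  rw [map_const_add_stdGaussian] at hid ⊢
  have hac := tilted_absolutelyContinuous (stdGaussian (EuclideanSpace ℝ ι)) (fun x ↦ ⟪a, x⟫)
  have hself := hac.ae_eq (llr_tilted_left (Measure.AbsolutelyContinuous.refl _) hint (by fun_prop))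
  have hzero := hac.ae_eq (llr_self (stdGaussian (EuclideanSpace ℝ ι)))
  have := isProbabilityMeasure_tilted hint
  refine (hid.sub (integrable_const
    (Real.log (∫ z, Real.exp ⟪a, z⟫ ∂(stdGaussian (EuclideanSpace ℝ ι)))))).congr ?_
  filter_upwards [hself, hzero] with x hx hx0
  simp only [Pi.sub_apply]
  rw [hx, hx0]
  simp

end GaussianShift

/-! ### Isotropic Gaussians with a common variance. -/

section IsoGaussian

variable {d : ℕ}

open scoped MatrixOrder in
lemma isoGaussian_eq_map (μ : Pred d) {σ : ℝ} (hσ : 0 ≤ σ) :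
    isoGaussian μ (σ ^ 2) = (stdGaussian (Pred d)).map (fun x ↦ μ + σ • x) := by
  have hsq : CFC.sqrt ((σ ^ 2) • (1 : Matrix (Fin d) (Fin d) ℝ)) = σ • 1 := by
    refine CFC.sqrt_unique ?_ ?_
    · simp [pow_two, smul_smul]
    · exact (Matrix.PosSemidef.one.smul hσ).nonneg
  rw [isoGaussian, multivariateGaussian, hsq]
  congr with x
  simp

instance isProbabilityMeasure_isoGaussian (μ : Pred d) (v : ℝ) :
    IsProbabilityMeasure (isoGaussian μ v) := by
  unfold isoGaussian; infer_instance

/-- Both Gaussians become images under the same affine map, so comparing them reduces to comparing a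
shifted standard Gaussian with the unshifted one. -/
lemma isoGaussian_eq_map_shift (μ ν : Pred d) {σ : ℝ} (hσ : 0 < σ) :
    isoGaussian μ (σ ^ 2) = ((stdGaussian (Pred d)).map (fun x ↦ σ⁻¹ • (μ - ν) + x)).map
      (fun x ↦ ν + σ • x) := by
  rw [isoGaussian_eq_map μ hσ.le, Measure.map_map (by fun_prop) (by fun_prop)]
  congr with x i
  simp [smul_smul, hσ.ne']
  ring

lemma isoGaussian_absolutelyContinuous (μ ν : Pred d) {σ : ℝ} (hσ : 0 < σ) :
    isoGaussian μ (σ ^ 2) ≪ isoGaussian ν (σ ^ 2) := by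
  rw [isoGaussian_eq_map_shift μ ν hσ, isoGaussian_eq_map ν hσ.le, map_const_add_stdGaussian]
  exact (tilted_absolutelyContinuous _ _).map (by fun_prop)

lemma integrable_llr_isoGaussian (μ ν : Pred d) {σ : ℝ} (hσ : 0 < σ) :
    Integrable (llr (isoGaussian μ (σ ^ 2)) (isoGaussian ν (σ ^ 2))) (isoGaussian μ (σ ^ 2)) := by
  have := Measure.isProbabilityMeasure_map (μ := stdGaussian (Pred d))
    (f := fun x ↦ σ⁻¹ • (μ - ν) + x) (by fun_prop)
  rw [isoGaussian_eq_map_shift μ ν hσ, isoGaussian_eq_map ν hσ.le]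
  refine InformationTheory.integrable_llr_map ?_ (by fun_prop)
    (integrable_llr_map_const_add_stdGaussian _)
  rw [map_const_add_stdGaussian]
  exact tilted_absolutelyContinuous _ _

lemma isoGaussian_eq_map_zero (μ : Pred d) {σ : ℝ} (hσ : 0 ≤ σ) :
    isoGaussian μ (σ ^ 2) = (isoGaussian 0 (σ ^ 2)).map (fun x ↦ μ + x) := by
  rw [isoGaussian_eq_map μ hσ, isoGaussian_eq_map 0 hσ, Measure.map_map (by fun_prop) (by fun_prop)]
  congr with x
  simp

end IsoGaussian

/-! ### Gaussian Poincaré inequality by rotation. -/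

section Poincare

lemma sq_intervalIntegral_le {u : ℝ → ℝ} (hu : Continuous u) :
    (∫ t in (0 : ℝ)..1, u t) ^ 2 ≤ ∫ t in (0 : ℝ)..1, u t ^ 2 := by
  set c := ∫ t in (0 : ℝ)..1, u t
  have h : ∫ t in (0 : ℝ)..1, (2 * c * u t - c ^ 2) ≤ ∫ t in (0 : ℝ)..1, u t ^ 2 := by
    refine intervalIntegral.integral_mono_on zero_le_one
      (Continuous.intervalIntegrable (by fun_prop) _ _)
      (Continuous.intervalIntegrable (by fun_prop) _ _) fun t _ ↦ ?_
    nlinarith [sq_nonneg (u t - c)]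
  rw [intervalIntegral.integral_sub (Continuous.intervalIntegrable (by fun_prop) _ _)
    (Continuous.intervalIntegrable (by fun_prop) _ _), intervalIntegral.integral_const_mul] at h
  simp only [intervalIntegral.integral_const, sub_zero, one_smul] at h
  linarith [show c * c = c ^ 2 by ring, show 2 * c * c = 2 * c ^ 2 by ring]

variable {E : Type*} [NormedAddCommGroup E] [InnerProductSpace ℝ E]

/-- A quarter-turn joins `p.1` to `p.2`. The fundamental theorem of calculus and Jensen along this
arc give the bound, with `(π / 2)² ≤ 4`. -/
lemma ofReal_sq_sub_le_lintegral_rotation {f : E → ℝ} (hf : ContDiff ℝ 1 f) (p : E × E) :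
    ENNReal.ofReal ((f p.2 - f p.1) ^ 2) ≤ ∫⁻ t in Set.Ioc (0 : ℝ) 1,
      ENNReal.ofReal (4 * (fderiv ℝ f (ContinuousLinearMap.rotation (Real.pi / 2 * t) p).1
        (ContinuousLinearMap.rotation (Real.pi / 2 * t) p).2) ^ 2) := by
  have hc : Continuous (fderiv ℝ f) := hf.continuous_fderiv one_ne_zero
  let u : ℝ → ℝ := fun t ↦ fderiv ℝ f (ContinuousLinearMap.rotation (Real.pi / 2 * t) p).1
    ((Real.pi / 2) • (ContinuousLinearMap.rotation (Real.pi / 2 * t) p).2)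
  have hu : Continuous u := by
    simp only [u, ContinuousLinearMap.rotation_apply]
    fun_prop
  have hder : ∀ t : ℝ, HasDerivAt
      (fun t ↦ f (ContinuousLinearMap.rotation (Real.pi / 2 * t) p).1) (u t) t := by
    intro t
    have hlin : HasDerivAt (fun t : ℝ ↦ Real.pi / 2 * t) (Real.pi / 2) t := by
      simpa using (hasDerivAt_id t).const_mul (Real.pi / 2)
    have hrot : HasDerivAt (fun t : ℝ ↦ (ContinuousLinearMap.rotation (Real.pi / 2 * t) p).1)
        ((Real.pi / 2) • (ContinuousLinearMap.rotation (Real.pi / 2 * t) p).2) t := by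
      simp only [ContinuousLinearMap.rotation_apply]
      refine ((hlin.cos.smul_const p.1).add (hlin.sin.smul_const p.2)).congr_deriv ?_
      rw [smul_add, smul_smul, smul_smul]
      congr 2 <;> ring
    exact ((hf.differentiable one_ne_zero _).hasFDerivAt).comp_hasDerivAt t hrot
  have hFTC : ∫ t in (0 : ℝ)..1, u t = f p.2 - f p.1 := by
    rw [intervalIntegral.integral_eq_sub_of_hasDerivAt (fun t _ ↦ hder t)
      (hu.intervalIntegrable _ _)]
    simp [ContinuousLinearMap.rotation_apply]
  have hsq := sq_intervalIntegral_le hu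
  rw [hFTC, intervalIntegral.integral_of_le zero_le_one] at hsq
  refine (ENNReal.ofReal_le_ofReal hsq).trans ?_
  have hint : IntegrableOn (fun t ↦ u t ^ 2) (Set.Ioc 0 1) :=
    (Continuous.integrableOn_Icc (by fun_prop)).mono_set Set.Ioc_subset_Icc_self
  rw [ofReal_integral_eq_lintegral_ofReal hint
    (Filter.Eventually.of_forall fun t ↦ sq_nonneg _)]
  refine lintegral_mono fun t ↦ ENNReal.ofReal_le_ofReal ?_
  simp only [u, map_smul, smul_eq_mul, mul_pow]
  gcongr
  nlinarith [Real.pi_pos, Real.pi_le_four]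

variable [FiniteDimensional ℝ E] [MeasurableSpace E] [BorelSpace E]

lemma lintegral_sq_dual_stdGaussian (L : StrongDual ℝ E) :
    ∫⁻ y, ENNReal.ofReal (L y ^ 2) ∂(stdGaussian E) = ENNReal.ofReal (‖L‖ ^ 2) := by
  have hL : MemLp L 2 (stdGaussian E) := L.comp_memLp' IsGaussian.memLp_two_id
  rw [← ofReal_integral_eq_lintegral_ofReal hL.integrable_sq
    (Filter.Eventually.of_forall fun _ ↦ sq_nonneg _), ← variance_dual_stdGaussian,
    variance_of_integral_eq_zero hL.aemeasurable (integral_strongDual_stdGaussian L)]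

/-- A form of the Gaussian Poincaré inequality, with a non-optimal constant. -/
lemma lintegral_sq_sub_stdGaussian_le {f : E → ℝ} (hf : ContDiff ℝ 1 f) :
    ∫⁻ p, ENNReal.ofReal ((f p.2 - f p.1) ^ 2) ∂((stdGaussian E).prod (stdGaussian E))
      ≤ ∫⁻ x, ENNReal.ofReal (4 * ‖fderiv ℝ f x‖ ^ 2) ∂(stdGaussian E) := by
  have hc : Continuous (fderiv ℝ f) := hf.continuous_fderiv one_ne_zero
  let φ : E × E → ℝ≥0∞ := fun q ↦ ENNReal.ofReal (4 * (fderiv ℝ f q.1 q.2) ^ 2)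
  have hφ : Measurable φ := by
    refine ENNReal.measurable_ofReal.comp (Continuous.measurable ?_)
    fun_prop
  have hrot : Measurable (fun q : (E × E) × ℝ ↦
      ContinuousLinearMap.rotation (Real.pi / 2 * q.2) q.1) := by
    simp only [ContinuousLinearMap.rotation_apply]
    exact Continuous.measurable (by fun_prop)
  calc ∫⁻ p, ENNReal.ofReal ((f p.2 - f p.1) ^ 2) ∂((stdGaussian E).prod (stdGaussian E))
      ≤ ∫⁻ p, (∫⁻ t in Set.Ioc (0 : ℝ) 1,
          φ (ContinuousLinearMap.rotation (Real.pi / 2 * t) p))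
          ∂((stdGaussian E).prod (stdGaussian E)) :=
        lintegral_mono fun p ↦ ofReal_sq_sub_le_lintegral_rotation hf p
    _ = ∫⁻ t in Set.Ioc (0 : ℝ) 1, (∫⁻ p,
          φ (ContinuousLinearMap.rotation (Real.pi / 2 * t) p)
          ∂((stdGaussian E).prod (stdGaussian E))) :=
        lintegral_lintegral_swap (hφ.comp hrot).aemeasurable
    -- The product Gaussian is rotation invariant, so the dependence on `t` disappears.
    _ = ∫⁻ _ in Set.Ioc (0 : ℝ) 1, (∫⁻ p, φ p ∂((stdGaussian E).prod (stdGaussian E))) := by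
        refine lintegral_congr fun t ↦ ?_
        rw [← lintegral_map hφ (ContinuousLinearMap.measurable _),
          IsGaussian.map_rotation_eq_self (by simp)]
    _ = ∫⁻ p, φ p ∂((stdGaussian E).prod (stdGaussian E)) := by simp
    _ = ∫⁻ x, ENNReal.ofReal (4 * ‖fderiv ℝ f x‖ ^ 2) ∂(stdGaussian E) := by
        rw [lintegral_prod _ hφ.aemeasurable]
        refine lintegral_congr fun x ↦ ?_
        simp only [φ]
        simp_rw [ENNReal.ofReal_mul (show (0 : ℝ) ≤ 4 by norm_num)]
        rw [lintegral_const_mul _ (by fun_prop), lintegral_sq_dual_stdGaussian]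

/-- For independent copies `X`, `Y`, `E (f Y - f X)²` is twice the variance of `f X`, so the
constant 4 becomes 2. -/
lemma integral_sq_stdGaussian_le {f : E → ℝ} (hf : ContDiff ℝ 1 f)
    (hf2 : MemLp f 2 (stdGaussian E))
    (hf' : Integrable (fun x ↦ ‖fderiv ℝ f x‖ ^ 2) (stdGaussian E)) :
    ∫ x, f x ^ 2 ∂(stdGaussian E)
      ≤ (∫ x, f x ∂(stdGaussian E)) ^ 2 + 2 * ∫ x, ‖fderiv ℝ f x‖ ^ 2 ∂(stdGaussian E) := by
  set γ := stdGaussian E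
  have hi : Integrable f γ := hf2.integrable one_le_two
  have hsq : Integrable (fun x ↦ f x ^ 2) γ := hf2.integrable_sq
  have hsq1 : Integrable (fun p : E × E ↦ f p.1 ^ 2) (γ.prod γ) := hsq.comp_fst γ
  have hsq2 : Integrable (fun p : E × E ↦ f p.2 ^ 2) (γ.prod γ) := hsq.comp_snd γ
  have hmul : Integrable (fun p : E × E ↦ f p.1 * f p.2) (γ.prod γ) := hi.mul_prod hi
  have hexp : ∀ p : E × E, (f p.2 - f p.1) ^ 2 = f p.2 ^ 2 + f p.1 ^ 2 - 2 * (f p.1 * f p.2) :=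
    fun p ↦ by ring
  have hint : Integrable (fun p : E × E ↦ (f p.2 - f p.1) ^ 2) (γ.prod γ) := by
    simp_rw [hexp]
    exact (hsq2.add hsq1).sub (hmul.const_mul 2)
  have heq : ∫ p, (f p.2 - f p.1) ^ 2 ∂(γ.prod γ) = 2 * ∫ x, f x ^ 2 ∂γ - 2 * (∫ x, f x ∂γ) ^ 2 := by
    simp_rw [hexp]
    rw [integral_sub (by exact hsq2.add hsq1) (hmul.const_mul 2), integral_add hsq2 hsq1,
      integral_const_mul, integral_prod_mul, integral_fun_fst (fun x ↦ f x ^ 2),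
      integral_fun_snd (fun x ↦ f x ^ 2)]
    simp
    ring
  have h := lintegral_sq_sub_stdGaussian_le hf
  rw [← ofReal_integral_eq_lintegral_ofReal hint
      (Filter.Eventually.of_forall fun _ ↦ sq_nonneg _),
    ← ofReal_integral_eq_lintegral_ofReal (hf'.const_mul 4)
      (Filter.Eventually.of_forall fun _ ↦ by positivity),
    ENNReal.ofReal_le_ofReal_iff (integral_nonneg fun _ ↦ by positivity), heq,
    integral_const_mul] at h
  linarith

lemma integral_sq_isoGaussian_le {d : ℕ} (μ : Pred d) {σ : ℝ} (hσ : 0 ≤ σ) {f : Pred d → ℝ}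
    (hf : ContDiff ℝ 1 f) (hf2 : MemLp f 2 (isoGaussian μ (σ ^ 2)))
    (hf' : Integrable (fun x ↦ ‖gradient f x‖ ^ 2) (isoGaussian μ (σ ^ 2))) :
    ∫ x, f x ^ 2 ∂(isoGaussian μ (σ ^ 2)) ≤ (∫ x, f x ∂(isoGaussian μ (σ ^ 2))) ^ 2
      + 2 * σ ^ 2 * ∫ x, ‖gradient f x‖ ^ 2 ∂(isoGaussian μ (σ ^ 2)) := by
  have hcg : Continuous (gradient f) :=
    (InnerProductSpace.toDual ℝ (Pred d)).symm.continuous.comp (hf.continuous_fderiv one_ne_zero)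
  rw [isoGaussian_eq_map μ hσ] at hf2 hf' ⊢
  have hmeas : AEMeasurable (fun x : Pred d ↦ μ + σ • x) (stdGaussian (Pred d)) := by fun_prop
  have hfd : ∀ x, fderiv ℝ (fun x ↦ f (μ + σ • x)) x = σ • fderiv ℝ f (μ + σ • x) := by
    intro x
    have h1 : HasFDerivAt (fun x : Pred d ↦ μ + σ • x) (σ • ContinuousLinearMap.id ℝ (Pred d)) x :=
      ((hasFDerivAt_id x).const_smul σ).const_add μ
    refine ((hf.differentiable one_ne_zero _).hasFDerivAt.comp x h1).fderiv.trans ?_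
    ext y
    simp
  have hnorm : ∀ x, ‖fderiv ℝ (fun x ↦ f (μ + σ • x)) x‖ ^ 2
      = σ ^ 2 * ‖gradient f (μ + σ • x)‖ ^ 2 := by
    intro x
    rw [hfd, norm_smul, mul_pow, gradient, LinearIsometryEquiv.norm_map, Real.norm_eq_abs, sq_abs]
  have hcf := hf.continuous
  rw [integral_map hmeas (Continuous.aestronglyMeasurable (by fun_prop)),
    integral_map hmeas (Continuous.aestronglyMeasurable (by fun_prop)),
    integral_map hmeas (Continuous.aestronglyMeasurable (by fun_prop))]
  rw [integrable_map_measure (Continuous.aestronglyMeasurable (by fun_prop)) hmeas] at hf'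
  rw [memLp_map_measure_iff hf.continuous.aestronglyMeasurable hmeas] at hf2
  have h := integral_sq_stdGaussian_le (f := fun x : Pred d ↦ f (μ + σ • x))
    (hf.comp (by fun_prop)) hf2 (by simp_rw [hnorm]; exact hf'.const_mul _)
  simp_rw [hnorm] at h
  rw [integral_const_mul] at h
  linarith

end Poincare

/-! ### Ville's maximal inequality. -/

section Ville

/-- **Ville's inequality** for nonnegative supermartingales, stated with set integrals. -/
lemma mul_measure_exists_le_lintegral {Ω : Type*} {mΩ : MeasurableSpace Ω} {μ : Measure Ω}
    (F : Filtration ℕ mΩ) {N : ℕ → Ω → ℝ≥0∞} (hN : ∀ n, Measurable[F n] (N n))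
    (hstep : ∀ n s, MeasurableSet[F n] s → ∫⁻ x in s, N (n + 1) x ∂μ ≤ ∫⁻ x in s, N n x ∂μ)
    (a : ℝ≥0∞) : a * μ {x | ∃ n, a ≤ N n x} ≤ ∫⁻ x, N 0 x ∂μ := by
  let B : ℕ → Set Ω := fun n ↦ {x | ∃ k ≤ n, a ≤ N k x}
  have hBF : ∀ n, MeasurableSet[F n] (B n) := by
    intro n
    have hB : B n = ⋃ k ∈ Finset.range (n + 1), {x | a ≤ N k x} := by
      ext x; simp [B]
    rw [hB]
    refine Finset.measurableSet_biUnion _ fun k hk ↦ ?_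
    exact F.mono (Nat.lt_succ_iff.1 (Finset.mem_range.1 hk)) _ (hN k measurableSet_Ici)
  have hBm : ∀ n, MeasurableSet (B n) := fun n ↦ F.le n _ (hBF n)
  have hBmono : Monotone B := fun n m hnm x ⟨k, hk, hx⟩ ↦ ⟨k, hk.trans hnm, hx⟩
  -- This is optional stopping: the process is frozen at `a` once it crosses. The left side does not
  -- increase with `n`, since points that have just crossed satisfy `a ≤ N (n + 1) x`.
  have key : ∀ n, a * μ (B n) + ∫⁻ x in (B n)ᶜ, N n x ∂μ ≤ ∫⁻ x, N 0 x ∂μ := by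
    intro n
    induction n with
    | zero =>
      have h0 : a * μ (B 0) ≤ ∫⁻ x in B 0, N 0 x ∂μ := by
        rw [← setLIntegral_const]
        refine setLIntegral_mono' (hBm 0) fun x ⟨k, hk, hx⟩ ↦ ?_
        rwa [Nat.le_zero.1 hk] at hx
      rw [← lintegral_add_compl (μ := μ) _ (hBm 0)]
      gcongr
    | succ n ih =>
      refine le_trans ?_ ih
      refine le_trans ?_ (add_le_add le_rfl (hstep n _ (hBF n).compl))
      have hsub : B n ⊆ B (n + 1) := hBmono n.le_succ
      have h1 : μ (B (n + 1)) = μ (B n) + μ (B (n + 1) \ B n) := by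
        rw [← measure_sdiff_add_inter (B (n + 1)) (hBm n),
          Set.inter_eq_self_of_subset_right hsub, add_comm]
      have h2 : ∫⁻ x in (B n)ᶜ, N (n + 1) x ∂μ = ∫⁻ x in B (n + 1) \ B n, N (n + 1) x ∂μ
          + ∫⁻ x in (B (n + 1))ᶜ, N (n + 1) x ∂μ := by
        rw [← lintegral_union (hBm _).compl]
        · congr 2
          ext x
          by_cases hx : x ∈ B (n + 1) <;> simp [hx]
          exact fun h ↦ hx (hsub h)
        · exact Set.disjoint_left.2 fun x hx hx' ↦ hx' hx.1
      rw [h1, h2, mul_add, add_assoc]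
      gcongr
      rw [← setLIntegral_const]
      refine setLIntegral_mono' ((hBm _).diff (hBm _)) fun x ⟨⟨k, hk, hx⟩, hx'⟩ ↦ ?_
      rcases Nat.le_succ_iff.1 hk with h | h
      · exact absurd ⟨k, h, hx⟩ hx'
      · rwa [h] at hx
  have hU : {x | ∃ n, a ≤ N n x} = ⋃ n, B n := by
    ext x
    simp only [Set.mem_ofPred_eq, Set.mem_iUnion, B]
    exact ⟨fun ⟨n, hn⟩ ↦ ⟨n, n, le_rfl, hn⟩, fun ⟨_, k, _, hk⟩ ↦ ⟨k, hk⟩⟩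
  rw [hU, hBmono.measure_iUnion, ENNReal.mul_iSup]
  exact iSup_le fun n ↦ le_self_add.trans (key n)

end Ville

/-! ### Mixture supermartingale on the i.i.d. sequence space. -/

section Product

variable {H Z : Type*} [MeasurableSpace H] [mZ : MeasurableSpace Z]

/-- The filtration on sequences generated by the first `n` coordinates. -/
def coordFiltration (Z : Type*) [MeasurableSpace Z] :
    Filtration ℕ (inferInstance : MeasurableSpace (ℕ → Z)) where
  seq n := MeasurableSpace.comap (fun (S : ℕ → Z) (i : Finset.range n) ↦ S i) inferInstance
  mono' := by
    intro n m hnm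
    refine Measurable.comap_le ?_
    have h : Measurable (fun (T : Finset.range m → Z) (i : Finset.range n) ↦
      T ⟨i, Finset.range_subset_range.2 hnm i.2⟩) := by fun_prop
    exact h.comp (comap_measurable _)
  le' := fun n ↦ Measurable.comap_le (by fun_prop)

/-- The mixture over `P` of the products of the weights `w h` along the first `n` points. -/
noncomputable def mixture (P : Measure H) (w : H → Z → ℝ≥0∞) (n : ℕ) (S : ℕ → Z) : ℝ≥0∞ :=
  ∫⁻ h, ∏ i ∈ Finset.range n, w h (S i) ∂P

variable {P : Measure H} [SFinite P] {w : H → Z → ℝ≥0∞}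

lemma measurable_coordFiltration_eval {n i : ℕ} (hi : i < n) :
    Measurable[coordFiltration Z n] (fun S : ℕ → Z ↦ S i) := by
  have h : Measurable (fun T : Finset.range n → Z ↦ T ⟨i, Finset.mem_range.2 hi⟩) := by fun_prop
  exact h.comp (comap_measurable _)

lemma measurable_coordFiltration_mixture (hw : Measurable (Function.uncurry w)) (n : ℕ) :
    Measurable[coordFiltration Z n] (mixture P w n) := by
  refine @Measurable.lintegral_prod_left' H (ℕ → Z) _ (coordFiltration Z n) P _
    (fun p ↦ ∏ i ∈ Finset.range n, w p.1 (p.2 i)) ?_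
  refine Finset.measurable_prod _ fun i hi ↦ ?_
  have h2 : @Measurable (H × (ℕ → Z)) Z (MeasurableSpace.prod inferInstance (coordFiltration Z n)) _
      (fun p ↦ p.2 i) :=
    (measurable_coordFiltration_eval (Finset.mem_range.1 hi)).comp measurable_snd
  exact hw.comp (measurable_fst.prodMk h2)

variable {D : Measure Z} [IsProbabilityMeasure D]

/-- After Tonelli in `h`, the factor `w h (S n)` is independent of the first `n` coordinates and has
mean at most one. -/
lemma setLIntegral_mixture_succ_le (hw : Measurable (Function.uncurry w))
    (hw1 : ∀ h, ∫⁻ z, w h z ∂D ≤ 1) (n : ℕ) {s : Set (ℕ → Z)}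
    (hs : MeasurableSet[coordFiltration Z n] s) :
    ∫⁻ S in s, mixture P w (n + 1) S ∂(Measure.infinitePi fun _ : ℕ ↦ D)
      ≤ ∫⁻ S in s, mixture P w n S ∂(Measure.infinitePi fun _ : ℕ ↦ D) := by
  have hs' : MeasurableSet s := (coordFiltration Z).le n _ hs
  have hprod : ∀ k, Measurable (fun p : (ℕ → Z) × H ↦ ∏ i ∈ Finset.range k, w p.2 (p.1 i)) := by
    intro k
    refine Finset.measurable_prod _ fun i _ ↦ ?_
    exact hw.comp (f := fun p : (ℕ → Z) × H ↦ (p.2, p.1 i)) (by fun_prop)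
  have hswap : ∀ k, ∫⁻ S in s, mixture P w k S ∂(Measure.infinitePi fun _ : ℕ ↦ D)
      = ∫⁻ h, ∫⁻ S in s, ∏ i ∈ Finset.range k, w h (S i) ∂(Measure.infinitePi fun _ : ℕ ↦ D) ∂P :=
    fun k ↦ lintegral_lintegral_swap (hprod k).aemeasurable
  rw [hswap, hswap]
  refine lintegral_mono fun h ↦ ?_
  have hwh : Measurable (w h) := hw.of_uncurry_left
  rw [← lintegral_indicator hs', ← lintegral_indicator hs']
  have hsplit : ∀ S, s.indicator (fun S ↦ ∏ i ∈ Finset.range (n + 1), w h (S i)) S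
      = s.indicator (fun S ↦ ∏ i ∈ Finset.range n, w h (S i)) S * w h (S n) := by
    intro S
    by_cases hS : S ∈ s <;> simp [hS, Finset.prod_range_succ]
  simp_rw [hsplit]
  have hind : IndepFun (fun (S : ℕ → Z) (i : Finset.range n) ↦ S i)
      (fun (S : ℕ → Z) (i : ({n} : Finset ℕ)) ↦ S i) (Measure.infinitePi fun _ : ℕ ↦ D) :=
    (iIndepFun_infinitePi (P := fun _ : ℕ ↦ D) (X := fun _ z ↦ z)
      (fun _ ↦ measurable_id)).indepFun_finset _ _ (by simp) (fun i ↦ measurable_pi_apply i)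
  have heval : Measurable[MeasurableSpace.comap
      (fun (S : ℕ → Z) (i : ({n} : Finset ℕ)) ↦ S i) inferInstance] (fun S ↦ w h (S n)) :=
    Measurable.comp (g := fun T : ({n} : Finset ℕ) → Z ↦ w h (T ⟨n, by simp⟩)) (by fun_prop)
      (comap_measurable _)
  rw [lintegral_mul_eq_lintegral_mul_lintegral_of_independent_measurableSpace
    ((coordFiltration Z).le n) (Measurable.comap_le (by fun_prop)) hind ?_
    heval]
  · refine mul_le_of_le_one_right' ?_
    rw [← lintegral_map (g := fun S : ℕ → Z ↦ S n) hwh (by fun_prop), Measure.infinitePi_map_eval]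
    exact hw1 h
  · refine Measurable.indicator ?_ hs
    exact Finset.measurable_prod _ fun i hi ↦
      hwh.comp (measurable_coordFiltration_eval (Finset.mem_range.1 hi))

lemma measure_exists_le_mixture [IsProbabilityMeasure P] (hw : Measurable (Function.uncurry w))
    (hw1 : ∀ h, ∫⁻ z, w h z ∂D ≤ 1) (a : ℝ≥0∞) :
    a * Measure.infinitePi (fun _ : ℕ ↦ D) {S | ∃ n, a ≤ mixture P w n S} ≤ 1 := by
  refine (mul_measure_exists_le_lintegral (coordFiltration Z)
    (measurable_coordFiltration_mixture hw)
    (fun n s hs ↦ setLIntegral_mixture_succ_le hw hw1 n hs) a).trans ?_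
  simp [mixture]

end Product

/-! ### Change of measure and the PAC-Bayes bound. -/

section PacBayesBound

/-- The **Donsker–Varadhan** variational inequality. -/
lemma integral_le_klDiv_add_log {H : Type*} [MeasurableSpace H] {P Q : Measure H}
    [IsProbabilityMeasure P] [IsProbabilityMeasure Q] (hQP : Q ≪ P)
    (hllr : Integrable (llr Q P) Q) {φ : H → ℝ} (hφ : Integrable φ Q)
    (hexp : Integrable (fun h ↦ Real.exp (φ h)) P) :
    ∫ h, φ h ∂Q ≤ (InformationTheory.klDiv Q P).toReal + Real.log (∫ h, Real.exp (φ h) ∂P) := by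
  have := isProbabilityMeasure_tilted hexp
  -- The inequality is nonnegativity of the divergence of `Q` from the tilt of `P` by `φ`.
  have h := InformationTheory.integral_llr_add_sub_measure_univ_nonneg
    (hQP.trans (absolutelyContinuous_tilted hexp))
    (integrable_llr_tilted_right hQP hφ hllr hexp)
  rw [integral_llr_tilted_right hQP hφ hexp hllr] at h
  rw [InformationTheory.toReal_klDiv_of_measure_eq hQP (by simp)]
  simp at h
  linarith

/-- Since `(1 - x + x²/2) (1 + x + x²/2) = 1 + x⁴/4 ≥ 1`, the quadratic lower bound on `exp x`
suffices. -/
lemma exp_neg_le_quadratic {x : ℝ} (hx : 0 ≤ x) : Real.exp (-x) ≤ 1 - x + x ^ 2 / 2 := by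
  have h := Real.quadratic_le_exp_of_nonneg hx
  have hpos : 0 ≤ 1 - x + x ^ 2 / 2 := by nlinarith [sq_nonneg (x - 1)]
  have h1 : 1 ≤ (1 - x + x ^ 2 / 2) * Real.exp x := by
    refine le_trans ?_ (mul_le_mul_of_nonneg_left h hpos)
    nlinarith [sq_nonneg (x ^ 2)]
  rw [Real.exp_neg, inv_eq_one_div, div_le_iff₀ (Real.exp_pos x)]
  exact h1

variable {d : ℕ} {Z : Type*} [MeasurableSpace Z]

/-- The weight `exp (-t f h z)`, normalised to have mean one in `z`. -/
noncomputable def expWeight (D : Measure Z) (f : Pred d → Z → ℝ) (t : ℝ) (h : Pred d) (z : Z) :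
    ℝ≥0∞ :=
  ENNReal.ofReal (Real.exp (-(t * f h z)))
    / ∫⁻ z', ENNReal.ofReal (Real.exp (-(t * f h z'))) ∂D

variable {D : Measure Z} [IsProbabilityMeasure D] {f : Pred d → Z → ℝ}

lemma measurable_expWeight (hf : Measurable (Function.uncurry f)) (t : ℝ) :
    Measurable (Function.uncurry (expWeight D f t)) := by
  have h : Measurable (fun p : Pred d × Z ↦ ENNReal.ofReal (Real.exp (-(t * f p.1 p.2)))) :=
    ENNReal.measurable_ofReal.comp (Real.measurable_exp.comp (hf.const_mul t).neg)
  exact h.div (h.lintegral_prod_right'.comp measurable_fst)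

lemma lintegral_expWeight_le (hf : Measurable (Function.uncurry f)) (t : ℝ) (h : Pred d) : ∫⁻ z, expWeight D f t h z ∂D ≤ 1 := by
  simp only [expWeight, div_eq_mul_inv]
  by_cases htop : (∫⁻ z', ENNReal.ofReal (Real.exp (-(t * f h z'))) ∂D)⁻¹ = ∞
  · rw [ENNReal.inv_eq_top] at htop
    have hfh : Measurable (f h) := hf.of_uncurry_left
    rw [lintegral_eq_zero_iff (by fun_prop)] at htop
    obtain ⟨z, hz⟩ := htop.exists
    simp [(Real.exp_pos _).not_ge] at hz
  · rw [lintegral_mul_const' _ _ htop]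
    exact ENNReal.mul_inv_le_one _

/-- The quadratic bound followed by `1 + x ≤ exp x` controls the normaliser. It needs finite moments
at `h`, known only for almost every `h`; the weight itself keeps the exact normaliser and so is
defined everywhere, independently of `Q`. -/
lemma ofReal_exp_le_expWeight {t : ℝ} (ht : 0 ≤ t) {h : Pred d} (hf0 : ∀ z, 0 ≤ f h z)
    (hi : Integrable (f h) D) (hi2 : Integrable (fun z ↦ f h z ^ 2) D) (z : Z) :
    ENNReal.ofReal (Real.exp (-(t * f h z)
        + (t * popRisk D f h - t ^ 2 / 2 * ∫ z, f h z ^ 2 ∂D)))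
      ≤ expWeight D f t h z := by
  have hint : Integrable (fun z ↦ 1 - t * f h z + t ^ 2 / 2 * f h z ^ 2) D :=
    ((integrable_const 1).sub (hi.const_mul t)).add (hi2.const_mul (t ^ 2 / 2))
  have hpt : ∀ z, Real.exp (-(t * f h z)) ≤ 1 - t * f h z + t ^ 2 / 2 * f h z ^ 2 := fun z ↦
    (exp_neg_le_quadratic (mul_nonneg ht (hf0 z))).trans_eq (by ring)
  have hc : ∫⁻ z', ENNReal.ofReal (Real.exp (-(t * f h z'))) ∂D
      ≤ ENNReal.ofReal (Real.exp (-(t * popRisk D f h - t ^ 2 / 2 * ∫ z, f h z ^ 2 ∂D))) := by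
    refine (lintegral_mono fun z ↦ ENNReal.ofReal_le_ofReal (hpt z)).trans ?_
    rw [← ofReal_integral_eq_lintegral_ofReal hint
      (Filter.Eventually.of_forall fun z ↦ (Real.exp_pos _).le.trans (hpt z)),
      integral_add (by exact (integrable_const 1).sub (hi.const_mul t)) (hi2.const_mul (t ^ 2 / 2)),
      integral_sub (integrable_const 1) (hi.const_mul t), integral_const_mul, integral_const_mul]
    refine ENNReal.ofReal_le_ofReal (le_trans ?_ (Real.add_one_le_exp _))
    simp only [integral_const, probReal_univ, one_smul, popRisk]
    linarith
  refine le_trans ?_ (ENNReal.div_le_div_left hc _)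
  rw [← ENNReal.ofReal_div_of_pos (Real.exp_pos _), ← Real.exp_sub, sub_neg_eq_add]

omit [MeasurableSpace Z] in
lemma integral_empRisk {Q : Measure (Pred d)} (hfz : ∀ z, Integrable (fun h ↦ f h z) Q)
    (S : ℕ → Z) (m : ℕ) :
    ∫ h, empRisk f S m h ∂Q = (1 / (m : ℝ)) * ∑ i ∈ Finset.range m, ∫ h, f h (S i) ∂Q := by
  simp only [empRisk]
  rw [integral_const_mul, integral_finsetSum _ fun i _ ↦ hfz (S i)]

lemma expPopRisk_le_of_mixture_lt {P Q : Measure (Pred d)} [IsProbabilityMeasure P]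
    [IsProbabilityMeasure Q] (hf0 : ∀ h z, 0 ≤ f h z) {t : ℝ} (ht : 0 < t) {a : ℝ} {S : ℕ → Z}
    {m : ℕ} (hm : 0 < m) (ha : mixture P (expWeight D f t) m S ≤ ENNReal.ofReal a)
    (hQP : Q ≪ P) (hPQ : P ≪ Q) (hllr : Integrable (llr Q P) Q)
    (hi : Integrable (Function.uncurry f) (Q.prod D))
    (hi2 : Integrable (fun p : Pred d × Z ↦ f p.1 p.2 ^ 2) (Q.prod D))
    (hfz : ∀ z, Integrable (fun h ↦ f h z) Q) :
    expPopRisk D f Q ≤ ∫ h, empRisk f S m h ∂Q + t / 2 * ∫ h, ∫ z, f h z ^ 2 ∂D ∂Q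
      + ((InformationTheory.klDiv Q P).toReal + Real.log a) / (t * m) := by
  let r : Pred d → ℝ := fun h ↦ t * popRisk D f h - t ^ 2 / 2 * ∫ z, f h z ^ 2 ∂D
  let φ : Pred d → ℝ := fun h ↦ ∑ i ∈ Finset.range m, (-(t * f h (S i)) + r h)
  have hR : Integrable (popRisk D f) Q := hi.integral_prod_left
  have hV : Integrable (fun h ↦ ∫ z, f h z ^ 2 ∂D) Q := hi2.integral_prod_left
  have hr : Integrable r Q := (hR.const_mul t).sub (hV.const_mul (t ^ 2 / 2))
  have hφi : ∀ i ∈ Finset.range m, Integrable (fun h ↦ -(t * f h (S i)) + r h) Q := fun i _ ↦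
    ((hfz (S i)).const_mul t).neg.add hr
  have hφ : Integrable φ Q := integrable_finsetSum _ hφi
  have hle : ∀ᵐ h ∂Q, ENNReal.ofReal (Real.exp (φ h))
      ≤ ∏ i ∈ Finset.range m, expWeight D f t h (S i) := by
    filter_upwards [hi.prod_right_ae, hi2.prod_right_ae] with h h1 h2
    simp only [φ]
    rw [Real.exp_sum, ENNReal.ofReal_prod_of_nonneg fun i _ ↦ (Real.exp_pos _).le]
    exact Finset.prod_le_prod' fun i _ ↦ ofReal_exp_le_expWeight ht.le (hf0 h) h1 h2 (S i)
  -- The moments are finite `Q`-almost everywhere; `P ≪ Q` carries the pointwise bound over to `P`.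
  have hlint : ∫⁻ h, ENNReal.ofReal (Real.exp (φ h)) ∂P ≤ ENNReal.ofReal a :=
    (lintegral_mono_ae (hPQ.ae_le hle)).trans ha
  have hφP : AEStronglyMeasurable φ P := hφ.1.mono_ac hPQ
  have hexp : Integrable (fun h ↦ Real.exp (φ h)) P := by
    refine ⟨Real.continuous_exp.comp_aestronglyMeasurable hφP, ?_⟩
    rw [hasFiniteIntegral_iff_ofReal (Filter.Eventually.of_forall fun _ ↦ (Real.exp_pos _).le)]
    exact hlint.trans_lt ENNReal.ofReal_lt_top
  have hpos : 0 < ∫ h, Real.exp (φ h) ∂P := integral_exp_pos hexp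
  have hint : ∫ h, Real.exp (φ h) ∂P ≤ a := by
    rw [← ofReal_integral_eq_lintegral_ofReal hexp
      (Filter.Eventually.of_forall fun _ ↦ (Real.exp_pos _).le)] at hlint
    by_contra hlt
    rw [ENNReal.ofReal_le_ofReal_iff'] at hlint
    rcases hlint with h | h <;> linarith
  have hDV := (integral_le_klDiv_add_log hQP hllr hφ hexp).trans
    (add_le_add le_rfl (Real.log_le_log hpos hint))
  have hφint : ∫ h, φ h ∂Q = -(t * ∑ i ∈ Finset.range m, ∫ h, f h (S i) ∂Q)
      + m * (t * expPopRisk D f Q - t ^ 2 / 2 * ∫ h, ∫ z, f h z ^ 2 ∂D ∂Q) := by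
    have hrint : ∫ h, r h ∂Q = t * expPopRisk D f Q - t ^ 2 / 2 * ∫ h, ∫ z, f h z ^ 2 ∂D ∂Q := by
      simp only [r]
      rw [integral_sub (hR.const_mul t) (hV.const_mul _), integral_const_mul, integral_const_mul]
      rfl
    simp only [φ]
    rw [integral_finsetSum _ hφi, Finset.mul_sum, ← Finset.sum_neg_distrib, ← hrint]
    rw [show (m : ℝ) * ∫ h, r h ∂Q = ∑ _i ∈ Finset.range m, ∫ h, r h ∂Q by simp,
      ← Finset.sum_add_distrib]
    refine Finset.sum_congr rfl fun i _ ↦ ?_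
    rw [integral_add (by exact ((hfz (S i)).const_mul t).neg) hr, integral_neg, integral_const_mul]
  have hm' : (0 : ℝ) < m := Nat.cast_pos.2 hm
  rw [integral_empRisk hfz, ← sub_nonneg]
  rw [hφint] at hDV
  have hgoal : 0 ≤ ((InformationTheory.klDiv Q P).toReal + Real.log a
      - (-(t * ∑ i ∈ Finset.range m, ∫ h, f h (S i) ∂Q)
      + m * (t * expPopRisk D f Q - t ^ 2 / 2 * ∫ h, ∫ z, f h z ^ 2 ∂D ∂Q))) / (t * m) :=
    div_nonneg (sub_nonneg.2 hDV) (by positivity)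
  refine hgoal.trans_eq ?_
  field_simp
  ring

/-- A time-uniform PAC-Bayes bound for nonnegative losses with a second moment. -/
lemma exists_event_expPopRisk_le (P : Measure (Pred d)) [IsProbabilityMeasure P]
    (hf : Measurable (Function.uncurry f)) (hf0 : ∀ h z, 0 ≤ f h z) {t : ℝ} (ht : 0 < t)
    {a : ℝ} (ha : 0 < a) :
    ∃ E : Set (ℕ → Z), MeasurableSet E ∧
      Measure.infinitePi (fun _ : ℕ ↦ D) Eᶜ ≤ ENNReal.ofReal a⁻¹ ∧
      ∀ S ∈ E, ∀ m : ℕ, 0 < m → ∀ Q : Measure (Pred d), IsProbabilityMeasure Q → Q ≪ P → P ≪ Q →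
        Integrable (llr Q P) Q → Integrable (Function.uncurry f) (Q.prod D) →
        Integrable (fun p : Pred d × Z ↦ f p.1 p.2 ^ 2) (Q.prod D) →
        (∀ z, Integrable (fun h ↦ f h z) Q) →
        expPopRisk D f Q ≤ ∫ h, empRisk f S m h ∂Q + t / 2 * ∫ h, ∫ z, f h z ^ 2 ∂D ∂Q
          + ((InformationTheory.klDiv Q P).toReal + Real.log a) / (t * m) := by
  have hw := measurable_expWeight (D := D) hf t
  -- The event is that the mixture never reaches `a`; it involves neither `m` nor `Q`, whence the
  -- uniformity in both.
  refine ⟨{S | ∃ n, ENNReal.ofReal a ≤ mixture P (expWeight D f t) n S}ᶜ, ?_, ?_, ?_⟩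
  · refine MeasurableSet.compl ?_
    rw [Set.ofPred_exists]
    exact MeasurableSet.iUnion fun n ↦ measurableSet_le measurable_const
      ((measurable_coordFiltration_mixture hw n).mono ((coordFiltration Z).le n) le_rfl)
  · rw [compl_compl, ENNReal.ofReal_inv_of_pos ha, ENNReal.le_inv_iff_mul_le, mul_comm]
    exact measure_exists_le_mixture hw (lintegral_expWeight_le hf t) _
  · intro S hS m hm Q hQ hQP hPQ hllr hi hi2 hfz
    refine expPopRisk_le_of_mixture_lt hf0 ht hm ?_ hQP hPQ hllr hi hi2 hfz
    simp only [Set.mem_compl_iff, Set.mem_ofPred_eq, not_exists, not_le] at hS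
    exact (hS m).le

end PacBayesBound

/-! ### Regularity of the squared gradient. -/

section Gradient

variable {d : ℕ} {Z : Type*} {ℓ : Pred d → Z → ℝ}

lemma gradSq_nonneg (h : Pred d) (z : Z) : 0 ≤ gradSq ℓ h z := sq_nonneg _

lemma contDiff_gradient {f : Pred d → ℝ} (hf : ContDiff ℝ 2 f) : ContDiff ℝ 1 (gradient f) :=
  (InnerProductSpace.toDual ℝ (Pred d)).symm.contDiff.comp
    (hf.fderiv_right (m := 1) (by norm_num))

lemma contDiff_gradSq {z : Z} (hf : ContDiff ℝ 2 (fun h ↦ ℓ h z)) :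
    ContDiff ℝ 1 (fun h ↦ gradSq ℓ h z) :=
  (contDiff_gradient hf).norm_sq ℝ

/-- The gradient of `‖∇ℓ‖²` is twice the Hessian applied to `∇ℓ`, and the Lipschitz condition bounds
the Hessian by `G`. -/
lemma sq_norm_gradient_gradSq_le {z : Z} {G : NNReal} (hf : ContDiff ℝ 2 (fun h ↦ ℓ h z))
    (hG : LipschitzWith G (gradient (fun h ↦ ℓ h z))) (h : Pred d) :
    ‖gradient (fun h ↦ gradSq ℓ h z) h‖ ^ 2 ≤ 4 * G ^ 2 * gradSq ℓ h z := by
  have hd := ((contDiff_gradient hf).differentiable one_ne_zero h).hasFDerivAt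
  have hb : ‖gradient (fun h ↦ gradSq ℓ h z) h‖ ≤ 2 * (‖gradient (fun h ↦ ℓ h z) h‖ * G) := by
    rw [gradient, LinearIsometryEquiv.norm_map]
    simp only [gradSq]
    rw [hd.norm_sq.fderiv, two_nsmul, ← two_smul ℝ, norm_smul, Real.norm_two]
    gcongr
    refine (ContinuousLinearMap.opNorm_comp_le _ _).trans ?_
    rw [innerSL_apply_norm]
    gcongr
    exact norm_fderiv_le_of_lipschitz ℝ hG
  calc ‖gradient (fun h ↦ gradSq ℓ h z) h‖ ^ 2
      ≤ (2 * (‖gradient (fun h ↦ ℓ h z) h‖ * G)) ^ 2 := by gcongr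
    _ = 4 * G ^ 2 * gradSq ℓ h z := by rw [gradSq]; ring

variable [MeasurableSpace Z]

/-- Directional derivatives are limits of difference quotients, which are measurable in `z`. -/
lemma measurable_gradSq (hℓ : ∀ h, Measurable (ℓ h))
    (hd : ∀ z, Differentiable ℝ (fun h ↦ ℓ h z)) (h : Pred d) : Measurable (gradSq ℓ h) := by
  have hfd : ∀ y : Pred d, Measurable (fun z ↦ fderiv ℝ (fun h' ↦ ℓ h' z) h y) := by
    intro y
    refine measurable_of_tendsto_metrizable
      (f := fun (n : ℕ) z ↦ (n : ℝ) • (ℓ (h + (n : ℝ)⁻¹ • y) z - ℓ h z)) (fun n ↦ ?_) ?_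
    · exact ((hℓ _).sub (hℓ _)).const_mul (n : ℝ)
    · exact tendsto_pi_nhds.2 fun z ↦
        ((hd z h).hasFDerivAt.lim_real y).comp tendsto_natCast_atTop_atTop
  have heq : gradSq ℓ h = fun z ↦ ∑ i, (fderiv ℝ (fun h' ↦ ℓ h' z) h
      (EuclideanSpace.single i 1)) ^ 2 := by
    ext z
    rw [gradSq, EuclideanSpace.real_norm_sq_eq]
    refine Finset.sum_congr rfl fun i _ ↦ ?_
    rw [← inner_gradient_left, EuclideanSpace.inner_single_right]
    simp
  rw [heq]
  exact Finset.measurable_sum _ fun i _ ↦ (hfd _).pow_const 2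

end Gradient

/-! ### Second moments from QSB and Poincaré. -/

section SecondMoment

variable {d : ℕ} {Z : Type*} [MeasurableSpace Z] {D : Measure Z} [IsProbabilityMeasure D]

lemma integral_err_eq_expPopRisk {f : Pred d → Z → ℝ} {Q : Measure (Pred d)} [SFinite Q]
    (hf : Integrable (Function.uncurry f) (Q.prod D)) :
    ∫ z, err f Q z ∂D = expPopRisk D f Q :=
  (integral_integral_swap hf).symm

variable {f b : Pred d → Z → ℝ} {μ : Pred d} {σ C : ℝ}

/-- The majorant `b` covers both uses: `gradSq ℓ` when `f = ℓ`, and `4 G² gradSq ℓ` when `f = gradSq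
ℓ`. -/
lemma ae_integral_sq_le (hσ : 0 ≤ σ)
    (hfz : ∀ z, ContDiff ℝ 1 (fun h ↦ f h z))
    (hH : ∀ z, MemH1 (fun h ↦ f h z) (isoGaussian μ (σ ^ 2)))
    (hb : ∀ h z, gradSq f h z ≤ b h z)
    (hbi : Integrable (Function.uncurry b) ((isoGaussian μ (σ ^ 2)).prod D)) :
    ∀ᵐ z ∂D, ∫ h, f h z ^ 2 ∂(isoGaussian μ (σ ^ 2))
      ≤ err f (isoGaussian μ (σ ^ 2)) z ^ 2 + 2 * σ ^ 2 * err b (isoGaussian μ (σ ^ 2)) z := by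
  filter_upwards [hbi.prod_left_ae] with z hz
  have hg := (hH z).memLp_gradient.integrable_sq
  refine (integral_sq_isoGaussian_le μ hσ (hfz z) (hH z).memLp hg).trans ?_
  simp only [err]
  gcongr
  exact fun h ↦ hb h z

lemma integrable_sq_of_QSB (hσ : 0 ≤ σ) (hf : Measurable (Function.uncurry f))
    (hfz : ∀ z, ContDiff ℝ 1 (fun h ↦ f h z))
    (hH : ∀ z, MemH1 (fun h ↦ f h z) (isoGaussian μ (σ ^ 2)))
    (hQ : QSB D f (isoGaussian μ (σ ^ 2)) C)
    (hb : ∀ h z, gradSq f h z ≤ b h z)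
    (hbi : Integrable (Function.uncurry b) ((isoGaussian μ (σ ^ 2)).prod D)) :
    Integrable (fun p : Pred d × Z ↦ f p.1 p.2 ^ 2) ((isoGaussian μ (σ ^ 2)).prod D) := by
  have hm : Measurable (fun p : Pred d × Z ↦ f p.1 p.2 ^ 2) := hf.pow_const 2
  rw [integrable_prod_iff' hm.aestronglyMeasurable]
  refine ⟨Filter.Eventually.of_forall fun z ↦ (hH z).memLp.integrable_sq, ?_⟩
  have hnorm : ∀ h z, ‖f h z ^ 2‖ = f h z ^ 2 := fun h z ↦ Real.norm_of_nonneg (sq_nonneg _)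
  simp only [hnorm]
  refine (hQ.integrable_err_sq.add (hbi.integral_prod_right.const_mul (2 * σ ^ 2))).mono'
    hm.stronglyMeasurable.integral_prod_left'.aestronglyMeasurable ?_
  filter_upwards [ae_integral_sq_le hσ hfz hH hb hbi] with z hz
  rw [Real.norm_eq_abs, abs_of_nonneg (integral_nonneg fun _ ↦ sq_nonneg _)]
  exact hz

lemma integral_sq_le_of_QSB (hσ : 0 ≤ σ) (hf : Measurable (Function.uncurry f))
    (hfz : ∀ z, ContDiff ℝ 1 (fun h ↦ f h z))
    (hH : ∀ z, MemH1 (fun h ↦ f h z) (isoGaussian μ (σ ^ 2)))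
    (hQ : QSB D f (isoGaussian μ (σ ^ 2)) C)
    (hb : ∀ h z, gradSq f h z ≤ b h z)
    (hbi : Integrable (Function.uncurry b) ((isoGaussian μ (σ ^ 2)).prod D)) :
    ∫ h, ∫ z, f h z ^ 2 ∂D ∂(isoGaussian μ (σ ^ 2))
      ≤ C * expPopRisk D f (isoGaussian μ (σ ^ 2))
        + 2 * σ ^ 2 * expPopRisk D b (isoGaussian μ (σ ^ 2)) := by
  have hi := integrable_sq_of_QSB hσ hf hfz hH hQ hb hbi
  have hbe : Integrable (fun z ↦ 2 * σ ^ 2 * err b (isoGaussian μ (σ ^ 2)) z) D :=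
    hbi.integral_prod_right.const_mul _
  rw [integral_integral_swap (f := fun h z ↦ f h z ^ 2) hi]
  refine (integral_mono_ae hi.integral_prod_right (hQ.integrable_err_sq.add hbe)
    (ae_integral_sq_le hσ hfz hH hb hbi)).trans ?_
  rw [integral_add' hQ.integrable_err_sq hbe, integral_const_mul, integral_err_eq_expPopRisk hbi]
  gcongr
  exact hQ.bound

end SecondMoment

/-! ### Sharpness, union bound and final arithmetic. -/

section Sharpness

variable {d : ℕ} {Z : Type*} {ℓ : Pred d → Z → ℝ}

lemma integrable_empRisk {f : Pred d → Z → ℝ} {Q : Measure (Pred d)}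
    (hf : ∀ z, Integrable (fun h ↦ f h z) Q) (S : ℕ → Z) (m : ℕ) :
    Integrable (empRisk f S m) Q :=
  (integrable_finsetSum _ fun i _ ↦ hf (S i)).const_mul _

lemma empRisk_nonneg {f : Pred d → Z → ℝ} (hf : ∀ h z, 0 ≤ f h z) (S : ℕ → Z) (m : ℕ)
    (h : Pred d) : 0 ≤ empRisk f S m h :=
  mul_nonneg (by positivity) (Finset.sum_nonneg fun i _ ↦ hf h (S i))

/-- The values at `μ` cancel, leaving an average over `μ + ν`, which has law `Q`. -/
lemma add_sharp_eq_integral (κ : ℝ) (S : ℕ → Z) (m : ℕ) (μ : Pred d) {σ : ℝ} (hσ : 0 ≤ σ)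
    (h1 : ∀ z, Integrable (fun h ↦ ℓ h z) (isoGaussian μ (σ ^ 2)))
    (h2 : ∀ z, Integrable (fun h ↦ gradSq ℓ h z) (isoGaussian μ (σ ^ 2))) :
    2 * empRisk ℓ S m μ + κ * gradEmpRisk ℓ S m μ + sharp κ ℓ S m μ (σ ^ 2)
      = 2 * ∫ h, empRisk ℓ S m h ∂(isoGaussian μ (σ ^ 2))
        + κ * ∫ h, empRisk (gradSq ℓ) S m h ∂(isoGaussian μ (σ ^ 2)) := by
  have hi1 : Integrable (fun h ↦ 2 * empRisk ℓ S m h) (isoGaussian μ (σ ^ 2)) :=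
    (integrable_empRisk h1 S m).const_mul 2
  have hi2 : Integrable (fun h ↦ κ * gradEmpRisk ℓ S m h) (isoGaussian μ (σ ^ 2)) :=
    (integrable_empRisk h2 S m).const_mul κ
  have hi : Integrable (fun h ↦ 2 * empRisk ℓ S m h + κ * gradEmpRisk ℓ S m h)
      (isoGaussian μ (σ ^ 2)) := hi1.add hi2
  have hmap := isoGaussian_eq_map_zero μ hσ
  have hint : ∫ ν, (2 * empRisk ℓ S m (μ + ν) + κ * gradEmpRisk ℓ S m (μ + ν))
        ∂(isoGaussian 0 (σ ^ 2))
      = ∫ h, (2 * empRisk ℓ S m h + κ * gradEmpRisk ℓ S m h) ∂(isoGaussian μ (σ ^ 2)) := by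
    rw [hmap] at hi ⊢
    rw [integral_map (by fun_prop) hi.1]
  have hi0 : Integrable (fun ν ↦ 2 * empRisk ℓ S m (μ + ν) + κ * gradEmpRisk ℓ S m (μ + ν))
      (isoGaussian 0 (σ ^ 2)) := by
    rw [hmap] at hi
    exact (integrable_map_measure hi.1 (by fun_prop)).1 hi
  rw [sharp, integral_sub hi0 (integrable_const _), hint, integral_add hi1 hi2,
    integral_const_mul, integral_const_mul]
  simp only [integral_const, probReal_univ, one_smul]
  rw [show empRisk (gradSq ℓ) S m = gradEmpRisk ℓ S m from rfl]
  ring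

end Sharpness

lemma ofReal_one_sub_le_measure_inter {Ω : Type*} [MeasurableSpace Ω] {μ : Measure Ω}
    [IsProbabilityMeasure μ] {A B : Set Ω} (hA : MeasurableSet A) (hB : MeasurableSet B) {δ : ℝ}
    (hδ : 0 ≤ δ) (hμA : μ Aᶜ ≤ ENNReal.ofReal (δ / 2)) (hμB : μ Bᶜ ≤ ENNReal.ofReal (δ / 2)) :
    ENNReal.ofReal (1 - δ) ≤ μ (A ∩ B) := by
  have h : μ (A ∩ B)ᶜ ≤ ENNReal.ofReal δ := by
    rw [Set.compl_inter]
    refine (measure_union_le _ _).trans ((add_le_add hμA hμB).trans_eq ?_)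
    rw [← ENNReal.ofReal_add (by positivity) (by positivity), add_halves]
  rw [← compl_compl (A ∩ B), prob_compl_eq_one_sub (hA.inter hB).compl,
    ENNReal.ofReal_sub _ hδ, ENNReal.ofReal_one]
  exact tsub_le_tsub_left h 1

/-- With `t = 1 / B`, half of `R₂` is absorbed; with `t = 1 / (4 C₁)`, an eighth of `R₁` is.
Multiplying by `8/7` gives coefficients `8/7`, `4/7` and `32/7`, relaxed to 2, 1 and 5. -/
lemma risk_le_of_self_bounds {R₁ R₂ V₁ V₂ r₁ r₂ A C₁ B s m : ℝ} (hC₁ : 0 < C₁) (hB : 0 < B)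
    (hs : 0 ≤ s) (hm : 0 < m) (hr₁ : 0 ≤ r₁) (hr₂ : 0 ≤ r₂) (hA : 0 ≤ A)
    (h₁ : R₁ ≤ r₁ + 1 / (4 * C₁) / 2 * V₁ + A / (1 / (4 * C₁) * m))
    (h₂ : R₂ ≤ r₂ + 1 / B / 2 * V₂ + A / (1 / B * m))
    (hV₁ : V₁ ≤ C₁ * R₁ + 2 * s * R₂) (hV₂ : V₂ ≤ B * R₂) :
    R₁ ≤ 2 * r₁ + s / C₁ * r₂ + (5 * C₁ + s / C₁ * B) * (A / m) := by
  have hx : 0 ≤ A / m := by positivity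
  have hq : 0 ≤ s / C₁ := by positivity
  have e1 : A / (1 / (4 * C₁) * m) = 4 * C₁ * (A / m) := by field_simp
  have e2 : A / (1 / B * m) = B * (A / m) := by field_simp
  have h2' : R₂ ≤ 2 * r₂ + 2 * (B * (A / m)) := by
    have : 1 / B / 2 * V₂ ≤ R₂ / 2 := by
      calc 1 / B / 2 * V₂ ≤ 1 / B / 2 * (B * R₂) := by gcongr
        _ = R₂ / 2 := by field_simp
    linarith
  have h1' : R₁ ≤ r₁ + R₁ / 8 + s / C₁ * R₂ / 4 + 4 * C₁ * (A / m) := by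
    have : 1 / (4 * C₁) / 2 * V₁ ≤ R₁ / 8 + s / C₁ * R₂ / 4 := by
      calc 1 / (4 * C₁) / 2 * V₁ ≤ 1 / (4 * C₁) / 2 * (C₁ * R₁ + 2 * s * R₂) := by gcongr
        _ = R₁ / 8 + s / C₁ * R₂ / 4 := by field_simp; ring
    linarith
  have h3 : s / C₁ * R₂ ≤ 2 * (s / C₁ * r₂) + 2 * (s / C₁ * B * (A / m)) := by
    calc s / C₁ * R₂ ≤ s / C₁ * (2 * r₂ + 2 * (B * (A / m))) := by gcongr
      _ = _ := by ring
  have p1 : 0 ≤ s / C₁ * r₂ := by positivity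
  have p2 : 0 ≤ s / C₁ * B * (A / m) := by positivity
  have p3 : 0 ≤ C₁ * (A / m) := by positivity
  linarith [add_mul (5 * C₁) (s / C₁ * B) (A / m), mul_assoc 5 C₁ (A / m),
    mul_assoc 4 C₁ (A / m)]

end PacBayes

theorem mainTheorem8 (C₁ C₂ σ : ℝ) (G : NNReal) (hC₁ : 0 < C₁) (hC₂ : 0 < C₂) (hσ : 0 < σ) :
    ∃ K : ℝ, 0 < K ∧
      ∀ (d : ℕ) (Z : Type*) [MeasurableSpace Z] (D : Measure Z) [IsProbabilityMeasure D]
        (ℓ : PacBayes.Pred d → Z → ℝ) (μP : PacBayes.Pred d) (δ : ℝ),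
        (∀ h, Measurable (ℓ h)) →
        (∀ h z, 0 ≤ ℓ h z) →
        (∀ z, ContDiff ℝ 2 (fun h => ℓ h z)) →
        (∀ z, LipschitzWith G (gradient (fun h => ℓ h z))) →
        0 < δ → δ ≤ 1 →
        ∃ E : Set (ℕ → Z), MeasurableSet E ∧
          ENNReal.ofReal (1 - δ) ≤ Measure.infinitePi (fun _ : ℕ => D) E ∧
          ∀ S ∈ E, ∀ m : ℕ, 0 < m → ∀ μQ : PacBayes.Pred d,
            PacBayes.QSB D ℓ (PacBayes.isoGaussian μQ (σ ^ 2)) C₁ →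
            PacBayes.QSB D (PacBayes.gradSq ℓ) (PacBayes.isoGaussian μQ (σ ^ 2)) C₂ →
            (∀ z, PacBayes.MemH1 (fun h => ℓ h z) (PacBayes.isoGaussian μQ (σ ^ 2))) →
            (∀ z, PacBayes.MemH1 (fun h => PacBayes.gradSq ℓ h z)
              (PacBayes.isoGaussian μQ (σ ^ 2))) →
            PacBayes.expPopRisk D ℓ (PacBayes.isoGaussian μQ (σ ^ 2)) ≤
              2 * PacBayes.empRisk ℓ S m μQ
                + (σ ^ 2 / C₁) * PacBayes.gradEmpRisk ℓ S m μQ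
                + PacBayes.sharp (σ ^ 2 / C₁) ℓ S m μQ (σ ^ 2)
                + K * (((InformationTheory.klDiv (PacBayes.isoGaussian μQ (σ ^ 2))
                    (PacBayes.isoGaussian μP (σ ^ 2))).toReal + Real.log (2 / δ)) / m) := by
  -- The second moment of `gradSq ℓ` is at most this constant times its risk: `C₂` from QSB, `8 σ²
  -- G² = 2 σ² · 4 G²` from Poincaré.
  have hB : 0 < C₂ + 8 * σ ^ 2 * (G : ℝ) ^ 2 := by positivity
  refine ⟨5 * C₁ + σ ^ 2 / C₁ * (C₂ + 8 * σ ^ 2 * (G : ℝ) ^ 2), by positivity, ?_⟩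
  intro d Z _ D _ ℓ μP δ hℓ hℓ0 hℓC hℓG hδ hδ1
  have hd : ∀ z, Differentiable ℝ (fun h ↦ ℓ h z) := fun z ↦ (hℓC z).differentiable two_ne_zero
  have hm1 : Measurable (Function.uncurry ℓ) :=
    measurable_uncurry_of_continuous_of_measurable (fun z ↦ (hℓC z).continuous) hℓ
  have hm2 : Measurable (Function.uncurry (PacBayes.gradSq ℓ)) :=
    measurable_uncurry_of_continuous_of_measurable
      (fun z ↦ (PacBayes.contDiff_gradSq (hℓC z)).continuous) (PacBayes.measurable_gradSq hℓ hd)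
  -- Level `2 / δ` makes each of the two events fail with probability at most `δ / 2`.
  obtain ⟨E₁, hE₁, hμ₁, h₁⟩ := PacBayes.exists_event_expPopRisk_le (D := D)
    (PacBayes.isoGaussian μP (σ ^ 2)) hm1 hℓ0 (t := 1 / (4 * C₁)) (by positivity)
    (a := 2 / δ) (by positivity)
  obtain ⟨E₂, hE₂, hμ₂, h₂⟩ := PacBayes.exists_event_expPopRisk_le (D := D)
    (PacBayes.isoGaussian μP (σ ^ 2)) hm2 PacBayes.gradSq_nonneg
    (t := 1 / (C₂ + 8 * σ ^ 2 * (G : ℝ) ^ 2)) (by positivity) (a := 2 / δ) (by positivity)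
  rw [inv_div] at hμ₁ hμ₂
  refine ⟨E₁ ∩ E₂, hE₁.inter hE₂,
    PacBayes.ofReal_one_sub_le_measure_inter hE₁ hE₂ hδ.le hμ₁ hμ₂, ?_⟩
  intro S hS m hm μQ hQ₁ hQ₂ hH₁ hH₂
  have hQP := PacBayes.isoGaussian_absolutelyContinuous μQ μP hσ
  have hPQ := PacBayes.isoGaussian_absolutelyContinuous μP μQ hσ
  have hllr := PacBayes.integrable_llr_isoGaussian μQ μP hσ
  have hi₁ := fun z ↦ (hH₁ z).memLp.integrable one_le_two
  have hi₂ := fun z ↦ (hH₂ z).memLp.integrable one_le_two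
  have hC₁ℓ : ∀ z, ContDiff ℝ 1 (fun h ↦ ℓ h z) := fun z ↦ (hℓC z).of_le one_le_two
  have hC₁g : ∀ z, ContDiff ℝ 1 (fun h ↦ PacBayes.gradSq ℓ h z) := fun z ↦
    PacBayes.contDiff_gradSq (hℓC z)
  have hgb : ∀ h z, PacBayes.gradSq (PacBayes.gradSq ℓ) h z
      ≤ 4 * (G : ℝ) ^ 2 * PacBayes.gradSq ℓ h z := fun h z ↦
    PacBayes.sq_norm_gradient_gradSq_le (hℓC z) (hℓG z) h
  have hgbi : Integrable (Function.uncurry fun h z ↦ 4 * (G : ℝ) ^ 2 * PacBayes.gradSq ℓ h z)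
      ((PacBayes.isoGaussian μQ (σ ^ 2)).prod D) := hQ₂.integrable.const_mul (4 * (G : ℝ) ^ 2)
  have hV₁ := PacBayes.integral_sq_le_of_QSB hσ.le hm1 hC₁ℓ hH₁ hQ₁ (fun _ _ ↦ le_rfl)
    hQ₂.integrable
  have hV₂ := PacBayes.integral_sq_le_of_QSB hσ.le hm2 hC₁g hH₂ hQ₂ hgb hgbi
  have hb₁ := h₁ S hS.1 m hm _ inferInstance hQP hPQ hllr hQ₁.integrable
    (PacBayes.integrable_sq_of_QSB hσ.le hm1 hC₁ℓ hH₁ hQ₁ (fun _ _ ↦ le_rfl) hQ₂.integrable) hi₁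
  have hb₂ := h₂ S hS.2 m hm _ inferInstance hQP hPQ hllr hQ₂.integrable
    (PacBayes.integrable_sq_of_QSB hσ.le hm2 hC₁g hH₂ hQ₂ hgb hgbi) hi₂
  have hlog : 0 ≤ Real.log (2 / δ) :=
    Real.log_nonneg (by rw [le_div_iff₀ hδ]; linarith)
  rw [PacBayes.add_sharp_eq_integral _ S m μQ hσ.le hi₁ hi₂]
  refine PacBayes.risk_le_of_self_bounds hC₁ hB (sq_nonneg σ) (Nat.cast_pos.2 hm)
    (integral_nonneg fun h ↦ PacBayes.empRisk_nonneg hℓ0 S m h)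
    (integral_nonneg fun h ↦ PacBayes.empRisk_nonneg PacBayes.gradSq_nonneg S m h)
    (add_nonneg ENNReal.toReal_nonneg hlog) hb₁ hb₂ hV₁ (hV₂.trans_eq ?_)
  have hconst : PacBayes.expPopRisk D (fun h z ↦ 4 * (G : ℝ) ^ 2 * PacBayes.gradSq ℓ h z)
      (PacBayes.isoGaussian μQ (σ ^ 2)) = 4 * (G : ℝ) ^ 2
        * PacBayes.expPopRisk D (PacBayes.gradSq ℓ) (PacBayes.isoGaussian μQ (σ ^ 2)) := by
    simp only [PacBayes.expPopRisk, PacBayes.popRisk, integral_const_mul]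
  rw [hconst]
  ring
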